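/- Let $\mathbb{S}$ and $\mathbb{U}$ be finite sets (states and controls), let $\mathcal{Q}(s^+,s,u)\ge 0$ with $\sum_{s^+\in\mathbb{S}}\mathcal{Q}(s^+,s,u)=1$ for all $(s,u)$ be the probability of moving from $s$ to $s^+$ under control $u$, and let $\mathbb{F}\subseteq\mathbb{S}$ be a set of forbidden states. A (memoryless) policy is a function $\mathcal{K}:\mathbb{U}\times\mathbb{S}\to[0,1]$ with $\sum_{u}\mathcal{K}(u,s)=1$ for all $s$; $\mathbb{K}$ is the set of all policies. Under $\mathcal{K}$ the state process $(S_k)_{k\ge 0}$ is a Markov chain with transition probabilities $\mathcal{Q}_{\mathcal{K}}(s^+,s)=\sum_{u}\mathcal{Q}(s^+,s,u)\,\mathcal{K}(u,s)$. Put $$\mathbb{S}^R_{\mathcal{K}}=\{s\in\mathbb{S}: P_{\mathcal{K}}(S_k=s\text{ for some }k>0\mid S_0=s)=1\},$$ $$\mathbb{S}^R_{\mathcal{K},\mathbb{F}}=\{s\in\mathbb{S}^R_{\mathcal{K}}: P_{\mathcal{K}}(S_k\in\mathbb{F}\text{ for some }k>0\mid S_0=s)=0\},\qquad \mathbb{S}^R_{\mathbb{F}}=\bigcup_{\mathcal{K}\in\mathbb{K}}\mathbb{S}^R_{\mathcal{K},\mathbb{F}}$$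 (the recurrent states, the $\mathbb{F}$-safe recurrent states, and the maximal set of $\mathbb{F}$-safe recurrent states). Consider the convex program of maximizing the entropy $\mathcal{H}(f)=-\sum_{s,u}f(s,u)\ln f(s,u)$ (with $0\ln 0=0$) over all probability mass functions $f$ on $\mathbb{S}\times\mathbb{U}$ subject to $$\sum_{u^+\in\mathbb{U}}f(s^+,u^+)=\sum_{s\in\mathbb{S},\,u\in\mathbb{U}}\mathcal{Q}(s^+,s,u)f(s,u)\quad(s^+\in\mathbb{S}),\qquad \sum_{u\in\mathbb{U}}f(s,u)=0\quad(s\in\mathbb{F}).$$ Suppose that this program is feasible. Then it has a unique optimal solution $f^*_{SU}$. Let $f^*_S(s)=\sum_{u}f^*_{SU}(s,u)$ and $\mathbb{W}_{f^*_S}=\{s\in\mathbb{S}: f^*_S(s)>0\}$. The following holds: (a) $\mathbb{S}^R_{\mathbb{F}}=\mathbb{W}_{f^*_S}$; (b) for every policy $\mathcal{G}$, the policy $\mathcal{K}^*$ given by $\mathcal{K}^*(u,s)=f^*_{SU}(s,u)/f^*_S(s)$ for $s\in\mathbb{W}_{f^*_S}$ and $\mathcal{K}^*(u,s)=\mathcal{G}(u,s)$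 otherwise satisfies $\mathbb{S}^R_{\mathcal{K}^*,\mathbb{F}}=\mathbb{S}^R_{\mathbb{F}}$. -/

import Mathlib

open MeasureTheory ProbabilityTheory Finset

namespace Surveillance

/-- Controlled dynamics on a finite state space `S` with controls `U`: `Q s' s u` is the
probability that the next state is `s'` when the current state is `s` and the control is `u`. -/
structure Dynamics (S U : Type*) [Fintype S] where
  prob : S → S → U → ℝ
  prob_nonneg : ∀ s' s u, 0 ≤ prob s' s u
  sum_prob : ∀ s u, ∑ s', prob s' s u = 1

instance {S U : Type*} [Fintype S] : CoeFun (Dynamics S U) (fun _ => S → S → U → ℝ) :=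
  ⟨Dynamics.prob⟩

/-- A (randomized) time-invariant memoryless control policy: `K u s` is the probability of
applying the control `u` in the state `s`. -/
structure Policy (S U : Type*) [Fintype U] where
  prob : U → S → ℝ
  prob_nonneg : ∀ u s, 0 ≤ prob u s
  sum_prob : ∀ s, ∑ u, prob u s = 1

instance {S U : Type*} [Fintype U] : CoeFun (Policy S U) (fun _ => U → S → ℝ) :=
  ⟨Policy.prob⟩

section

variable {S U : Type*} [Fintype S] [Fintype U]

/-- The closed-loop transition probability `Q_K(s', s)`. -/
def closedLoop (Q : Dynamics S U) (K : Policy S U) (s' s : S) : ℝ :=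
  ∑ u, Q s' s u * K u s

theorem closedLoop_nonneg (Q : Dynamics S U) (K : Policy S U) (s' s : S) :
    0 ≤ closedLoop Q K s' s :=
  Finset.sum_nonneg fun u _ => mul_nonneg (Q.prob_nonneg s' s u) (K.prob_nonneg u s)

theorem sum_closedLoop (Q : Dynamics S U) (K : Policy S U) (s : S) :
    ∑ s', closedLoop Q K s' s = 1 := by
  simp only [closedLoop]
  rw [Finset.sum_comm]
  simp only [← Finset.sum_mul, Q.sum_prob, one_mul, K.sum_prob]

section PathLaw

variable [MeasurableSpace S] [MeasurableSingletonClass S]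

/-- The one-step transition kernel of the closed-loop Markov chain. -/
noncomputable def stepKernel (Q : Dynamics S U) (K : Policy S U) : Kernel S S :=
  Kernel.ofFunOfCountable fun s =>
    ∑ s', ENNReal.ofReal (closedLoop Q K s' s) • Measure.dirac s'

instance (Q : Dynamics S U) (K : Policy S U) : IsMarkovKernel (stepKernel Q K) := by
  refine ⟨fun s => ⟨?_⟩⟩
  change (∑ s', ENNReal.ofReal (closedLoop Q K s' s) • Measure.dirac s') Set.univ = 1
  rw [Measure.finsetSum_apply]
  simp only [Measure.smul_apply, measure_univ, smul_eq_mul, mul_one]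
  rw [← ENNReal.ofReal_sum_of_nonneg fun s' _ => closedLoop_nonneg Q K s' s,
    sum_closedLoop, ENNReal.ofReal_one]

/-- The step kernel, seen as a function of the whole history up to time `n`. -/
noncomputable def historyKernel (Q : Dynamics S U) (K : Policy S U) (n : ℕ) :
    Kernel ((i : Finset.Iic n) → (fun _ : ℕ => S) i) S :=
  (stepKernel Q K).comap (fun x => x ⟨n, Finset.mem_Iic.2 le_rfl⟩) (measurable_pi_apply _)

instance (Q : Dynamics S U) (K : Policy S U) (n : ℕ) :
    IsMarkovKernel (historyKernel Q K n) := by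
  unfold historyKernel
  infer_instance

/-- The law on `ℕ → S` of the closed-loop Markov chain `(S_k)` with transition probabilities
`Q_K` and `S_0 = s`. -/
noncomputable def pathLaw (Q : Dynamics S U) (K : Policy S U) (s : S) : Measure (ℕ → S) :=
  Kernel.traj (X := fun _ => S) (historyKernel Q K) 0 (fun _ => s)

/-- The set of states that are recurrent under the policy `K`. -/
def recurrentSet (Q : Dynamics S U) (K : Policy S U) : Set S :=
  {s | pathLaw Q K s {ω | ∃ k > 0, ω k = s} = 1}

/-- The set of `F`-safe recurrent states under `K`: the recurrent states from which the chain
has probability zero of ever moving into `F`. -/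
def safeRecurrentSet (Q : Dynamics S U) (F : Set S) (K : Policy S U) : Set S :=
  {s ∈ recurrentSet Q K | pathLaw Q K s {ω | ∃ k > 0, ω k ∈ F} = 0}

/-- The maximal set of `F`-safe recurrent states. -/
def maxSafeRecurrentSet (Q : Dynamics S U) (F : Set S) : Set S :=
  ⋃ K : Policy S U, safeRecurrentSet Q F K

end PathLaw

/-- The state marginal of a joint pmf on `S × U`. -/
def marginal (f : S × U → ℝ) (s : S) : ℝ := ∑ u, f (s, u)

/-- The support of the state marginal. -/
def marginalSupport (f : S × U → ℝ) : Set S := {s | 0 < marginal f s}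

/-- The entropy of a joint pmf (`Real.log 0 = 0`, so `0 ln 0 = 0`). -/
noncomputable def entropy (f : S × U → ℝ) : ℝ := -∑ u, ∑ s, f (s, u) * Real.log (f (s, u))

/-- The feasible set of the program: joint pmfs on `S × U` that are stationary under `Q` and
put no mass on the forbidden states. -/
def feasibleSet (Q : Dynamics S U) (F : Set S) : Set (S × U → ℝ) :=
  {f | f ∈ stdSimplex ℝ (S × U) ∧
    (∀ s', ∑ u', f (s', u') = ∑ s, ∑ u, Q s' s u * f (s, u)) ∧
    ∀ s ∈ F, ∑ u, f (s, u) = 0}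

/-- `f` is an optimal solution of the maximum-entropy program. -/
def IsOptimal (Q : Dynamics S U) (F : Set S) (f : S × U → ℝ) : Prop :=
  f ∈ feasibleSet Q F ∧ ∀ g ∈ feasibleSet Q F, entropy g ≤ entropy f

open Classical in
/-- The policy `K*(u, s) = f(s, u) / f_S(s)` on the support of the marginal `f_S`, and
`G(u, s)` elsewhere. -/
noncomputable def policyOf (f : S × U → ℝ) (hf : f ∈ stdSimplex ℝ (S × U)) (G : Policy S U) :
    Policy S U where
  prob u s := if s ∈ marginalSupport f then f (s, u) / marginal f s else G u s
  prob_nonneg u s := by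
    split_ifs with h
    · exact div_nonneg (hf.1 _) (le_of_lt h)
    · exact G.prob_nonneg u s
  sum_prob s := by
    split_ifs with h
    · rw [← Finset.sum_div]
      exact div_self (ne_of_gt h)
    · exact G.sum_prob s

end

end Surveillance

/-! A feasible point is a stationary distribution of some closed loop that does not charge `F`,
split over controls by the policy. The marginal of a feasible `f` is stationary under the policy
read off from `f`, so its support is closed, misses `F` and consists of recurrent states
(`marginalSupport_subset_safeRecurrentSet`). Conversely, each safe recurrent state of any policy is
charged by such a stationary distribution (`exists_stationary_of_mem_safeRecurrentSet`), hence by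
the marginal of a feasible point. Since the slope of `-x ln x` at `0` is infinite, the optimum
charges every pair that some feasible point charges (`IsOptimal.pos_of_pos`). Thus the maximal safe
set lies in the support of the optimal marginal, which lies in the safe set of `K*`, which lies in
the maximal safe set: all are equal.

Path events enter only through `mem_safeRecurrentSet_iff`, which turns them into equations for
`avoid`. Existence and uniqueness of the optimum are compactness and strict concavity. -/

namespace Surveillance

/-! ### Avoidance probabilities by first-step analysis -/

section Avoidance

variable {S : Type*} [Fintype S]

/-- The probability that the chain with transition probabilities `p s' s` avoids `B` at the times
`1, …, n`, as a function of the initial state. -/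
noncomputable def avoidUpTo (p : S → S → ℝ) (B : Set S) : ℕ → S → ℝ
  | 0 => fun _ => 1
  | n + 1 => fun x => ∑ z, p z x * Bᶜ.indicator (avoidUpTo p B n) z

/-- The probability that the chain with transition probabilities `p s' s` avoids `B` at all
positive times, as a function of the initial state. -/
noncomputable def avoid (p : S → S → ℝ) (B : Set S) (x : S) : ℝ := ⨅ n, avoidUpTo p B n x

variable {p : S → S → ℝ} {B : Set S}

theorem avoidUpTo_nonneg (hp : ∀ z x, 0 ≤ p z x) (n : ℕ) (x : S) : 0 ≤ avoidUpTo p B n x := by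
  induction n generalizing x with
  | zero => exact zero_le_one
  | succ n ih =>
    exact sum_nonneg fun z _ => mul_nonneg (hp z x) (Set.indicator_nonneg (fun z _ => ih z) z)

theorem avoidUpTo_succ_le (hp : ∀ z x, 0 ≤ p z x) (hp1 : ∀ x, ∑ z, p z x = 1) (n : ℕ) (x : S) :
    avoidUpTo p B (n + 1) x ≤ avoidUpTo p B n x := by
  induction n generalizing x with
  | zero =>
    refine (sum_le_sum fun z _ => mul_le_mul_of_nonneg_left
      (Set.indicator_le_self' (fun _ _ => zero_le_one) z) (hp z x)).trans_eq ?_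
    simp [avoidUpTo, hp1]
  | succ n ih =>
    exact sum_le_sum fun z _ => mul_le_mul_of_nonneg_left
      (Set.indicator_le_indicator (ih z)) (hp z x)

theorem tendsto_avoidUpTo (hp : ∀ z x, 0 ≤ p z x) (hp1 : ∀ x, ∑ z, p z x = 1) (x : S) :
    Filter.Tendsto (fun n => avoidUpTo p B n x) Filter.atTop (nhds (avoid p B x)) :=
  tendsto_atTop_ciInf (antitone_nat_of_succ_le fun n => avoidUpTo_succ_le hp hp1 n x)
    ⟨0, by rintro _ ⟨n, rfl⟩; exact avoidUpTo_nonneg hp n x⟩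

theorem avoid_nonneg (hp : ∀ z x, 0 ≤ p z x) (x : S) : 0 ≤ avoid p B x :=
  Real.iInf_nonneg fun n => avoidUpTo_nonneg hp n x

theorem avoid_le_one (hp : ∀ z x, 0 ≤ p z x) (x : S) : avoid p B x ≤ 1 :=
  ciInf_le (f := fun n => avoidUpTo p B n x)
    ⟨0, by rintro _ ⟨n, rfl⟩; exact avoidUpTo_nonneg hp n x⟩ 0

theorem avoid_eq_sum (hp : ∀ z x, 0 ≤ p z x) (hp1 : ∀ x, ∑ z, p z x = 1) (x : S) :
    avoid p B x = ∑ z, p z x * Bᶜ.indicator (avoid p B) z := by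
  refine tendsto_nhds_unique
    ((Filter.tendsto_add_atTop_iff_nat 1).2 (tendsto_avoidUpTo hp hp1 x)) ?_
  refine tendsto_finsetSum _ fun z _ => Filter.Tendsto.const_mul _ ?_
  by_cases hz : z ∈ B
  · simp [hz]
  · simpa [hz] using tendsto_avoidUpTo hp hp1 z

/-- A chain started in a closed set disjoint from `B` never visits `B`. -/
theorem avoid_eq_one_of_closed (hp1 : ∀ x, ∑ z, p z x = 1) {A : Set S}
    (hA : ∀ x ∈ A, ∀ z, p z x ≠ 0 → z ∈ A) (hAB : Disjoint A B) {x : S} (hx : x ∈ A) :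
    avoid p B x = 1 := by
  have key : ∀ n, ∀ x ∈ A, avoidUpTo p B n x = 1 := by
    intro n
    induction n with
    | zero => exact fun _ _ => rfl
    | succ n ih =>
      intro x hx
      rw [← hp1 x]
      refine sum_congr rfl fun z _ => ?_
      by_cases hz : p z x = 0
      · simp [hz]
      · have hzA := hA x hx z hz
        rw [Set.indicator_of_mem (Set.disjoint_left.1 hAB hzA), ih z hzA, mul_one]
  simp [avoid, key _ x hx]

/-- A state that cannot avoid `B` only leads to states in `B` or states that cannot avoid `B`. -/
theorem indicator_avoid_eq_zero (hp : ∀ z x, 0 ≤ p z x) (hp1 : ∀ x, ∑ z, p z x = 1) {x z : S}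
    (hx : avoid p B x = 0) (hz : p z x ≠ 0) : Bᶜ.indicator (avoid p B) z = 0 := by
  rw [avoid_eq_sum hp hp1, sum_eq_zero_iff_of_nonneg fun z _ =>
    mul_nonneg (hp z x) (Set.indicator_nonneg (fun z _ => avoid_nonneg hp z) z)] at hx
  exact (mul_eq_zero.1 (hx z (mem_univ z))).resolve_left hz

/-- A state that surely avoids `B` only leads to states outside `B` that surely avoid `B`. -/
theorem indicator_avoid_eq_one (hp : ∀ z x, 0 ≤ p z x) (hp1 : ∀ x, ∑ z, p z x = 1) {x z : S}
    (hx : avoid p B x = 1) (hz : p z x ≠ 0) : Bᶜ.indicator (avoid p B) z = 1 := by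
  have hle : ∀ z, Bᶜ.indicator (avoid p B) z ≤ 1 := fun z =>
    Set.indicator_apply_le' (fun _ => avoid_le_one hp z) fun _ => zero_le_one
  have h0 : ∑ z, p z x * (1 - Bᶜ.indicator (avoid p B) z) = 0 := by
    simp only [mul_sub, mul_one, sum_sub_distrib, ← avoid_eq_sum hp hp1, hp1, hx, sub_self]
  rw [sum_eq_zero_iff_of_nonneg fun z _ => mul_nonneg (hp z x) (sub_nonneg.2 (hle z))] at h0
  exact (sub_eq_zero.1 ((mul_eq_zero.1 (h0 z (mem_univ z))).resolve_left hz)).symm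

/-- A state charged by a stationary measure is recurrent. -/
theorem avoid_singleton_self_eq_zero (hp : ∀ z x, 0 ≤ p z x) (hp1 : ∀ x, ∑ z, p z x = 1)
    {π : S → ℝ} (hπ : ∀ z, π z = ∑ x, p z x * π x) {s : S} (hs : π s ≠ 0) :
    avoid p {s} s = 0 := by
  classical
  -- Integrate the first-step equation against `π`. The two sides differ only in the term at `s`,
  -- which leaves `π s * avoid p {s} s = 0`.
  have h1 : ∑ x, π x * avoid p {s} x = ∑ z, π z * ({s}ᶜ : Set S).indicator (avoid p {s}) z := by
    calc ∑ x, π x * avoid p {s} x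
        = ∑ x, ∑ z, π x * (p z x * ({s}ᶜ : Set S).indicator (avoid p {s}) z) := by
          simp_rw [← mul_sum]
          exact sum_congr rfl fun x _ => by rw [← avoid_eq_sum hp hp1 x]
      _ = ∑ z, (∑ x, p z x * π x) * ({s}ᶜ : Set S).indicator (avoid p {s}) z := by
          rw [sum_comm]
          refine sum_congr rfl fun z _ => ?_
          rw [sum_mul]
          exact sum_congr rfl fun x _ => by ring
      _ = _ := sum_congr rfl fun z _ => by rw [← hπ z]
  rw [← sub_eq_zero, ← sum_sub_distrib, sum_eq_single s] at h1
  · simpa [hs] using h1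
  · intro z _ hz
    simp [hz]
  · simp

end Avoidance

/-! ### Stationary distributions of finite chains -/

section Stationary

/-- A finite Markov chain has a stationary distribution. -/
theorem exists_stationary {T : Type*} [Fintype T] [Nonempty T] {p : T → T → ℝ}
    (hp : ∀ z x, 0 ≤ p z x) (hp1 : ∀ x, ∑ z, p z x = 1) :
    ∃ π ∈ stdSimplex ℝ T, ∀ z, π z = ∑ x, p z x * π x := by
  classical
  let M : Matrix T T ℝ := Matrix.of p - 1
  -- The all-ones vector is a left null vector, so a right null vector `v` exists too, of unknown
  -- sign.
  have hdet : M.det = 0 := by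
    refine Matrix.exists_vecMul_eq_zero_iff.1 ⟨fun _ => 1, ?_, ?_⟩
    · exact fun h => one_ne_zero (congrFun h (Classical.arbitrary T))
    · ext x
      simp [M, Matrix.vecMul, dotProduct, hp1, Matrix.one_apply]
  obtain ⟨v, hv0, hv⟩ := Matrix.exists_mulVec_eq_zero_iff.2 hdet
  have hv' : ∀ z, v z = ∑ x, p z x * v x := by
    intro z
    have := congrFun hv z
    simp only [M, Matrix.sub_mulVec, Matrix.one_mulVec, Pi.sub_apply, Pi.zero_apply,
      sub_eq_zero] at this
    exact this.symm
  -- `|v|` is subinvariant, and one step preserves its total mass, so every inequality is an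
  -- equality.
  have hle : ∀ z, |v z| ≤ ∑ x, p z x * |v x| := fun z => by
    rw [hv' z]
    refine (abs_sum_le_sum_abs _ _).trans_eq (sum_congr rfl fun x _ => ?_)
    rw [abs_mul, abs_of_nonneg (hp z x)]
  have hsum : ∑ z, |v z| = ∑ z, ∑ x, p z x * |v x| := by
    rw [sum_comm]
    simp_rw [← sum_mul, hp1, one_mul]
  have heq := (sum_eq_sum_iff_of_le fun z _ => hle z).1 hsum
  obtain ⟨a, ha⟩ := Function.ne_iff.1 hv0
  have hpos : 0 < ∑ z, |v z| :=
    sum_pos' (fun z _ => abs_nonneg _) ⟨a, mem_univ a, abs_pos.2 ha⟩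
  refine ⟨fun z => |v z| / ∑ z, |v z|, ⟨fun z => by positivity, ?_⟩, fun z => ?_⟩
  · rw [← sum_div, div_self hpos.ne']
  · simp_rw [mul_div_assoc', ← sum_div, ← heq z (mem_univ z)]

/-- A nonempty closed set of states carries a stationary distribution. -/
theorem exists_stationary_of_closed {S : Type*} [Fintype S] {p : S → S → ℝ}
    (hp : ∀ z x, 0 ≤ p z x) (hp1 : ∀ x, ∑ z, p z x = 1) {C : Set S} (hne : C.Nonempty)
    (hC : ∀ x ∈ C, ∀ z, p z x ≠ 0 → z ∈ C) :
    ∃ π ∈ stdSimplex ℝ S, (∀ z, π z = ∑ x, p z x * π x) ∧ ∀ z, z ∉ C → π z = 0 := by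
  classical
  have : Nonempty C := hne.to_subtype
  have sum_C : ∀ f : S → ℝ, (∀ x, x ∉ C → f x = 0) → ∑ x : C, f x = ∑ x, f x := by
    intro f hf
    rw [← Fintype.sum_subtype_add_sum_subtype (· ∈ C) f,
      sum_eq_zero (s := (univ : Finset {x // x ∉ C})) fun x _ => hf x x.2, add_zero]
  obtain ⟨π, ⟨h0, h1⟩, hπ⟩ := exists_stationary (T := C) (p := fun z x => p z x)
    (fun z x => hp z x) fun x => by
      rw [sum_C (fun z => p z x) fun z hz => by_contra fun h => hz (hC x x.2 z h), hp1]
  let ρ : S → ℝ := fun z => if h : z ∈ C then π ⟨z, h⟩ else 0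
  have hρ : ∀ z : C, ρ z = π z := fun z => dif_pos z.2
  have hρ0 : ∀ z, z ∉ C → ρ z = 0 := fun z hz => dif_neg hz
  refine ⟨ρ, ⟨fun z => ?_, ?_⟩, fun z => ?_, hρ0⟩
  · by_cases h : z ∈ C
    · simpa [ρ, h] using h0 ⟨z, h⟩
    · simp [ρ, h]
  · rw [← sum_C ρ hρ0, ← h1]
    exact sum_congr rfl fun z _ => hρ z
  · rw [← sum_C _ fun x hx => by rw [hρ0 x hx, mul_zero]]
    simp_rw [hρ]
    by_cases h : z ∈ C
    · exact (hρ ⟨z, h⟩).trans (hπ ⟨z, h⟩)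
    · rw [hρ0 z h, sum_eq_zero]
      intro x _
      rw [by_contra fun hz => h (hC x x.2 z hz), zero_mul]

end Stationary

/-! ### From the path measure to avoidance probabilities -/

section PathLaw

variable {S U : Type*} [Fintype S] [Fintype U] [MeasurableSpace S] [MeasurableSingletonClass S]

theorem lintegral_stepKernel (Q : Dynamics S U) (K : Policy S U) (x : S) (φ : S → ENNReal) :
    ∫⁻ z, φ z ∂(stepKernel Q K x) = ∑ z, ENNReal.ofReal (closedLoop Q K z x) * φ z := by
  change ∫⁻ z, φ z ∂(∑ s', ENNReal.ofReal (closedLoop Q K s' x) • Measure.dirac s') = _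
  simp [lintegral_finsetSum_measure, lintegral_smul_measure]

/-- The Markov property at time `m`: the joint law of the history and the next state is a
composition-product with the step kernel. -/
theorem lintegral_pathLaw_succ (Q : Dynamics S U) (K : Policy S U) (s : S) (m : ℕ)
    (φ : (Finset.Iic m → S) → S → ENNReal) :
    ∫⁻ ω, φ (Preorder.frestrictLe m ω) (ω (m + 1)) ∂(pathLaw Q K s) =
      ∫⁻ ω, ∑ z, ENNReal.ofReal (closedLoop Q K z (ω m)) * φ (Preorder.frestrictLe m ω) z
        ∂(pathLaw Q K s) := by
  have hφ : Measurable (fun q : (Finset.Iic m → S) × S => φ q.1 q.2) := Measurable.of_discrete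
  have h1 := Kernel.partialTraj_compProd_eq_map_traj (X := fun _ => S)
    (κ := historyKernel Q K) (Nat.zero_le m) (x₀ := fun _ => s)
  have h2 := Kernel.traj_map_frestrictLe_apply (X := fun _ => S)
    (κ := historyKernel Q K) 0 m (fun _ => s)
  calc ∫⁻ ω, φ (Preorder.frestrictLe m ω) (ω (m + 1)) ∂(pathLaw Q K s)
      = ∫⁻ q, φ q.1 q.2 ∂((pathLaw Q K s).map
          fun ω => (Preorder.frestrictLe (π := fun _ => S) m ω, ω (m + 1))) := by
        rw [lintegral_map hφ (by fun_prop)]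
    _ = ∫⁻ h, ∫⁻ z, φ h z ∂(historyKernel Q K m h)
          ∂((pathLaw Q K s).map (Preorder.frestrictLe (π := fun _ => S) m)) := by
        unfold pathLaw
        rw [← h1, h2, Measure.lintegral_compProd hφ]
    _ = _ := by
        rw [lintegral_map Measurable.of_discrete (by fun_prop)]
        refine lintegral_congr fun ω => ?_
        exact lintegral_stepKernel Q K (ω m) _

-- The weight with free horizon `n` makes induction on `m` work: integrating out the last step turns
-- horizon `n` at time `m + 1` into horizon `n + 1` at time `m`. Only `n = 0` is used afterwards.
open Classical in
theorem lintegral_pathLaw_avoidUpTo (Q : Dynamics S U) (K : Policy S U) (B : Set S) (s : S)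
    (m n : ℕ) :
    ∫⁻ ω, (if ∀ k > 0, k ≤ m → ω k ∉ B then
        ENNReal.ofReal (avoidUpTo (closedLoop Q K) B n (ω m)) else 0) ∂(pathLaw Q K s) =
      ENNReal.ofReal (avoidUpTo (closedLoop Q K) B (n + m) s) := by
  induction m generalizing n with
  | zero =>
    have h2 := Kernel.traj_map_frestrictLe_apply (X := fun _ => S)
      (κ := historyKernel Q K) 0 0 (fun _ => s)
    have hc : ∀ ω : ℕ → S, ∀ k > 0, k ≤ 0 → ω k ∉ B := fun ω k hk hk' => by omega
    refine (lintegral_congr fun ω => if_pos (hc ω)).trans ?_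
    rw [add_zero]
    calc ∫⁻ ω, ENNReal.ofReal (avoidUpTo (closedLoop Q K) B n (ω 0)) ∂(pathLaw Q K s)
        = ∫⁻ h, ENNReal.ofReal (avoidUpTo (closedLoop Q K) B n (h ⟨0, by simp⟩))
          ∂((pathLaw Q K s).map (Preorder.frestrictLe (π := fun _ => S) 0)) := by
          rw [lintegral_map Measurable.of_discrete (by fun_prop)]
          rfl
      _ = _ := by
          unfold pathLaw
          rw [h2, Kernel.partialTraj_self, Kernel.id_apply, lintegral_dirac]
  | succ m ih =>
    have h := lintegral_pathLaw_succ Q K s m fun h z =>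
      if (∀ k, (hk : k ∈ Finset.Iic m) → 0 < k → h ⟨k, hk⟩ ∉ B) ∧ z ∉ B then
        ENNReal.ofReal (avoidUpTo (closedLoop Q K) B n z) else 0
    have e : n + (m + 1) = n + 1 + m := by omega
    rw [e, ← ih (n + 1)]
    refine Eq.trans (lintegral_congr fun ω => ?_) (h.trans (lintegral_congr fun ω => ?_))
    · refine if_congr ⟨fun h => ⟨fun k hk h0 => h k h0 ((Finset.mem_Iic.1 hk).trans m.le_succ),
        h _ m.succ_pos le_rfl⟩, fun h k h0 hk => ?_⟩ rfl rfl
      rcases hk.eq_or_lt with rfl | hk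
      · exact h.2
      · exact h.1 k (Finset.mem_Iic.2 (Nat.lt_succ_iff.1 hk)) h0
    · have hiff : (∀ k, (hk : k ∈ Finset.Iic m) → 0 < k →
          Preorder.frestrictLe (π := fun _ => S) m ω ⟨k, hk⟩ ∉ B) ↔
          ∀ k > 0, k ≤ m → ω k ∉ B :=
        ⟨fun h k h0 hk => h k (Finset.mem_Iic.2 hk) h0,
          fun h k hk h0 => h k h0 (Finset.mem_Iic.1 hk)⟩
      simp only [hiff]
      split_ifs with hω
      · have hnn : ∀ z, 0 ≤ Bᶜ.indicator (avoidUpTo (closedLoop Q K) B n) z := fun z =>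
          Set.indicator_nonneg (fun z _ => avoidUpTo_nonneg (closedLoop_nonneg Q K) n z) z
        rw [avoidUpTo, ENNReal.ofReal_sum_of_nonneg fun z _ =>
          mul_nonneg (closedLoop_nonneg Q K z _) (hnn z)]
        refine sum_congr rfl fun z _ => ?_
        rw [ENNReal.ofReal_mul (closedLoop_nonneg Q K z _)]
        by_cases hz : z ∈ B
        · simp [hz]
        · rw [if_pos ⟨hω, hz⟩, Set.indicator_of_mem hz]
      · simp [hω]

instance (Q : Dynamics S U) (K : Policy S U) (s : S) : IsProbabilityMeasure (pathLaw Q K s) := by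
  unfold pathLaw
  infer_instance

theorem measurableSet_avoid_upTo (B : Set S) (m : ℕ) :
    MeasurableSet {ω : ℕ → S | ∀ k > 0, k ≤ m → ω k ∉ B} := by
  simp only [Set.ofPred_forall]
  exact MeasurableSet.iInter fun k => MeasurableSet.iInter fun _ => MeasurableSet.iInter fun _ =>
    (MeasurableSet.of_discrete (s := Bᶜ)).preimage (measurable_pi_apply k)

theorem pathLaw_avoid_upTo (Q : Dynamics S U) (K : Policy S U) (B : Set S) (s : S) (m : ℕ) :
    pathLaw Q K s {ω | ∀ k > 0, k ≤ m → ω k ∉ B} =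
      ENNReal.ofReal (avoidUpTo (closedLoop Q K) B m s) := by
  classical
  have h := lintegral_pathLaw_avoidUpTo Q K B s m 0
  rw [zero_add] at h
  rw [← h, ← lintegral_indicator_one (measurableSet_avoid_upTo B m)]
  refine lintegral_congr fun ω => ?_
  simp [Set.indicator_apply, avoidUpTo]

theorem pathLaw_avoid (Q : Dynamics S U) (K : Policy S U) (B : Set S) (s : S) :
    pathLaw Q K s {ω | ∀ k > 0, ω k ∉ B} = ENNReal.ofReal (avoid (closedLoop Q K) B s) := by
  have hset : {ω : ℕ → S | ∀ k > 0, ω k ∉ B} = ⋂ m, {ω | ∀ k > 0, k ≤ m → ω k ∉ B} := by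
    ext ω
    simp only [Set.mem_ofPred_eq, Set.mem_iInter]
    exact ⟨fun h m k h0 _ => h k h0, fun h k h0 => h k k h0 le_rfl⟩
  have hlim := tendsto_measure_iInter_atTop (μ := pathLaw Q K s)
    (fun m => (measurableSet_avoid_upTo B m).nullMeasurableSet)
    (fun m n hmn ω hω k h0 hk => hω k h0 (hk.trans hmn)) ⟨0, measure_ne_top _ _⟩
  rw [hset]
  refine tendsto_nhds_unique hlim ?_
  simp only [Function.comp_def, pathLaw_avoid_upTo]
  exact ENNReal.tendsto_ofReal (tendsto_avoidUpTo (closedLoop_nonneg Q K) (sum_closedLoop Q K) s)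

theorem pathLaw_hit (Q : Dynamics S U) (K : Policy S U) (B : Set S) (s : S) :
    pathLaw Q K s {ω | ∃ k > 0, ω k ∈ B} = 1 - ENNReal.ofReal (avoid (closedLoop Q K) B s) := by
  have hset : {ω : ℕ → S | ∃ k > 0, ω k ∈ B} = {ω | ∀ k > 0, ω k ∉ B}ᶜ := by
    ext ω
    simp
  have hm : MeasurableSet {ω : ℕ → S | ∀ k > 0, ω k ∉ B} := by
    simp only [Set.ofPred_forall]
    exact MeasurableSet.iInter fun k => MeasurableSet.iInter fun _ =>
      (MeasurableSet.of_discrete (s := Bᶜ)).preimage (measurable_pi_apply k)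
  rw [hset, prob_compl_eq_one_sub hm, pathLaw_avoid]

theorem mem_recurrentSet_iff (Q : Dynamics S U) (K : Policy S U) (s : S) :
    s ∈ recurrentSet Q K ↔ avoid (closedLoop Q K) {s} s = 0 := by
  have h := pathLaw_hit Q K {s} s
  simp only [Set.mem_singleton_iff] at h
  rw [recurrentSet, Set.mem_ofPred_eq, h]
  have h0 := avoid_nonneg (B := {s}) (closedLoop_nonneg Q K) s
  constructor
  · intro h
    by_contra hne
    have : 0 < ENNReal.ofReal (avoid (closedLoop Q K) {s} s) :=
      ENNReal.ofReal_pos.2 (lt_of_le_of_ne h0 (Ne.symm hne))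
    exact (ENNReal.sub_lt_self ENNReal.one_ne_top one_ne_zero this.ne').ne h
  · intro h
    simp [h]

theorem mem_safeRecurrentSet_iff (Q : Dynamics S U) (F : Set S) (K : Policy S U) (s : S) :
    s ∈ safeRecurrentSet Q F K ↔
      avoid (closedLoop Q K) {s} s = 0 ∧ avoid (closedLoop Q K) F s = 1 := by
  rw [safeRecurrentSet, Set.mem_sep_iff, mem_recurrentSet_iff, pathLaw_hit, tsub_eq_zero_iff_le,
    ENNReal.one_le_ofReal]
  exact and_congr_right fun _ =>
    ⟨fun h => le_antisymm (avoid_le_one (closedLoop_nonneg Q K) s) h, fun h => h.ge⟩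

end PathLaw

/-! ### The maximum-entropy program -/

section Entropy

variable {S U : Type*} [Fintype S] [Fintype U]

theorem entropy_eq_sum_negMulLog (f : S × U → ℝ) : entropy f = ∑ q, Real.negMulLog (f q) := by
  rw [entropy, Fintype.sum_prod_type_right]
  simp [Real.negMulLog]

theorem continuous_entropy : Continuous (entropy : (S × U → ℝ) → ℝ) := by
  rw [funext entropy_eq_sum_negMulLog]
  fun_prop

theorem strictConcaveOn_entropy :
    StrictConcaveOn ℝ (stdSimplex ℝ (S × U)) (entropy : (S × U → ℝ) → ℝ) := by
  refine ⟨convex_stdSimplex ℝ _, fun f hf g hg hfg a b ha hb hab => ?_⟩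
  obtain ⟨i, hi⟩ := Function.ne_iff.1 hfg
  simp only [entropy_eq_sum_negMulLog, smul_sum, ← sum_add_distrib]
  refine sum_lt_sum (fun q _ => ?_) ⟨i, mem_univ i, ?_⟩
  · exact Real.concaveOn_negMulLog.2 (hf.1 q) (hg.1 q) ha.le hb.le hab
  · exact Real.strictConcaveOn_negMulLog.2 (hf.1 i) (hg.1 i) hi ha hb hab

theorem convex_feasibleSet (Q : Dynamics S U) (F : Set S) : Convex ℝ (feasibleSet Q F) := by
  rintro f ⟨hf, hfs, hfF⟩ g ⟨hg, hgs, hgF⟩ a b ha hb hab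
  refine ⟨convex_stdSimplex ℝ _ hf hg ha hb hab, fun s' => ?_, fun s hs => ?_⟩
  · simp only [Pi.add_apply, Pi.smul_apply, smul_eq_mul, sum_add_distrib, mul_add,
      mul_left_comm _ a, mul_left_comm _ b, ← mul_sum, hfs s', hgs s']
  · simp only [Pi.add_apply, Pi.smul_apply, smul_eq_mul, sum_add_distrib, ← mul_sum, hfF s hs,
      hgF s hs, mul_zero, add_zero]

theorem isCompact_feasibleSet (Q : Dynamics S U) (F : Set S) : IsCompact (feasibleSet Q F) := by
  have h1 : IsClosed {f : S × U → ℝ |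
      ∀ s', ∑ u', f (s', u') = ∑ s, ∑ u, Q s' s u * f (s, u)} := by
    simp only [Set.ofPred_forall]
    exact isClosed_iInter fun s' => isClosed_eq (by fun_prop) (by fun_prop)
  have h2 : IsClosed {f : S × U → ℝ | ∀ s ∈ F, ∑ u, f (s, u) = 0} := by
    simp only [Set.ofPred_forall]
    exact isClosed_iInter fun s => isClosed_iInter fun _ => isClosed_eq (by fun_prop) (by fun_prop)
  exact (isCompact_stdSimplex ℝ (S × U)).inter_right (h1.inter h2)

theorem existsUnique_isOptimal (Q : Dynamics S U) (F : Set S) (h : (feasibleSet Q F).Nonempty) :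
    ∃! f : S × U → ℝ, IsOptimal Q F f := by
  obtain ⟨f, hf, hmax⟩ :=
    (isCompact_feasibleSet Q F).exists_isMaxOn h continuous_entropy.continuousOn
  refine ⟨f, ⟨hf, fun g hg => hmax hg⟩, fun g hg => ?_⟩
  exact (strictConcaveOn_entropy.subset (fun _ h => h.1) (convex_feasibleSet Q F)).eq_of_isMaxOn
    (fun g' hg' => hg.2 g' hg') hmax hg.1 hf

/-- The support of the optimal solution contains the support of every feasible solution: the
entropy has an infinite slope at the boundary of the simplex. -/
theorem IsOptimal.pos_of_pos {Q : Dynamics S U} {F : Set S} {f g : S × U → ℝ}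
    (hf : IsOptimal Q F f) (hg : g ∈ feasibleSet Q F) {i : S × U} (hi : 0 < g i) : 0 < f i := by
  classical
  by_contra hfi
  have hfi : f i = 0 := le_antisymm (not_lt.1 hfi) (hf.1.1.1 i)
  -- Compare `f` with `(1 - t) f + t g`. Concavity bounds the other coordinates from below; at `i`,
  -- where `f` vanishes, there is an exact extra gain `-t g i log t`. Optimality and division by `t`
  -- give the bound.
  have key : ∀ t : ℝ, 0 < t → t < 1 → -(g i * Real.log t) ≤ entropy f - entropy g := by
    intro t ht ht1
    have hmem : (1 - t) • f + t • g ∈ feasibleSet Q F :=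
      convex_feasibleSet Q F hf.1 hg (by linarith) ht.le (by ring)
    have hmax := hf.2 _ hmem
    have hlow : ∑ q, ((1 - t) * Real.negMulLog (f q) + t * Real.negMulLog (g q) +
        if q = i then -(t * g i * Real.log t) else 0) ≤
        ∑ q, Real.negMulLog (((1 - t) • f + t • g) q) := by
      refine sum_le_sum fun q _ => ?_
      split_ifs with hq
      · subst hq
        simp only [Pi.add_apply, Pi.smul_apply, smul_eq_mul, hfi, mul_zero, zero_add,
          Real.negMulLog_zero, Real.negMulLog_mul]
        refine le_of_eq ?_
        simp only [Real.negMulLog]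
        ring
      · rw [add_zero]
        exact Real.concaveOn_negMulLog.2 (hf.1.1.1 q) (hg.1.1 q) (by linarith) ht.le (by ring)
    rw [← entropy_eq_sum_negMulLog] at hlow
    simp only [sum_add_distrib, ← mul_sum, ← entropy_eq_sum_negMulLog, sum_ite_eq', mem_univ,
      if_true] at hlow
    have : t * -(g i * Real.log t) ≤ t * (entropy f - entropy g) := by nlinarith
    exact le_of_mul_le_mul_left this ht
  -- This `t` makes the left side of `key` equal to `|entropy f - entropy g| + 1`.
  have h := key (Real.exp (-((|entropy f - entropy g| + 1) / g i))) (Real.exp_pos _)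
    (Real.exp_lt_one_iff.2 (neg_lt_zero.2 (by positivity)))
  rw [Real.log_exp, mul_neg, neg_neg, mul_div_cancel₀ _ hi.ne'] at h
  linarith [le_abs_self (entropy f - entropy g)]

end Entropy

/-! ### Feasible points, policies and safe recurrent states -/

section Policies

variable {S U : Type*} [Fintype S] [Fintype U] {Q : Dynamics S U} {F : Set S}

theorem marginal_nonneg {f : S × U → ℝ} (hf : f ∈ stdSimplex ℝ (S × U)) (s : S) :
    0 ≤ marginal f s :=
  sum_nonneg fun u _ => hf.1 (s, u)

/-- Part (a) mentions no `G`, so some policy is needed to form `policyOf`; a pmf on `S × U` supplies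
a control. -/
theorem nonempty_policy {f : S × U → ℝ} (hf : f ∈ stdSimplex ℝ (S × U)) :
    Nonempty (Policy S U) := by
  classical
  obtain ⟨⟨_, u⟩, -, -⟩ : ∃ q ∈ univ, f q ≠ 0 :=
    exists_ne_zero_of_sum_ne_zero (by rw [hf.2]; exact one_ne_zero)
  exact ⟨{ prob := fun v _ => if v = u then 1 else 0
           prob_nonneg := fun v _ => by split_ifs <;> norm_num
           sum_prob := fun _ => by simp }⟩

theorem policyOf_mul_marginal {f : S × U → ℝ} (hf : f ∈ stdSimplex ℝ (S × U)) (G : Policy S U)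
    (u : U) (s : S) : policyOf f hf G u s * marginal f s = f (s, u) := by
  classical
  by_cases hs : 0 < marginal f s
  · have : policyOf f hf G u s = f (s, u) / marginal f s := if_pos hs
    rw [this, div_mul_cancel₀ _ hs.ne']
  · have h0 : marginal f s = 0 := le_antisymm (not_lt.1 hs) (marginal_nonneg hf s)
    rw [h0, mul_zero]
    exact ((sum_eq_zero_iff_of_nonneg fun u _ => hf.1 (s, u)).1 h0 u (mem_univ u)).symm

/-- The state marginal of a feasible solution is stationary under the induced policy. -/
theorem marginal_eq_sum_closedLoop {f : S × U → ℝ} (hf : f ∈ feasibleSet Q F) (G : Policy S U)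
    (z : S) :
    marginal f z = ∑ x, closedLoop Q (policyOf f hf.1 G) z x * marginal f x := by
  rw [marginal, hf.2.1 z]
  refine sum_congr rfl fun x _ => ?_
  rw [closedLoop, sum_mul]
  exact sum_congr rfl fun u _ => by rw [mul_assoc, policyOf_mul_marginal]

/-- The support of a stationary measure is closed under the transitions of the chain. -/
theorem stationary_pos {p : S → S → ℝ} (hp : ∀ z x, 0 ≤ p z x) {π : S → ℝ} (hπ0 : ∀ x, 0 ≤ π x)
    (hπ : ∀ z, π z = ∑ x, p z x * π x) {x z : S} (hx : 0 < π x) (hz : p z x ≠ 0) : 0 < π z := by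
  rw [hπ z]
  exact sum_pos' (fun y _ => mul_nonneg (hp z y) (hπ0 y))
    ⟨x, mem_univ x, mul_pos (lt_of_le_of_ne (hp z x) hz.symm) hx⟩

/-- A stationary distribution of a closed loop that does not charge `F` gives a feasible
solution. -/
theorem mem_feasibleSet_of_stationary (K : Policy S U) {π : S → ℝ} (hπ : π ∈ stdSimplex ℝ S)
    (hst : ∀ z, π z = ∑ x, closedLoop Q K z x * π x) (hF : ∀ s ∈ F, π s = 0) :
    (fun q : S × U => π q.1 * K q.2 q.1) ∈ feasibleSet Q F := by
  have hm : ∀ s, ∑ u, π s * K u s = π s := fun s => by rw [← mul_sum, K.sum_prob, mul_one]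
  refine ⟨⟨fun q => mul_nonneg (hπ.1 q.1) (K.prob_nonneg q.2 q.1), ?_⟩, fun z => ?_, fun s hs => ?_⟩
  · rw [Fintype.sum_prod_type]
    simp only [hm, hπ.2]
  · simp only [hm]
    rw [hst z]
    refine sum_congr rfl fun x _ => ?_
    rw [closedLoop, sum_mul]
    exact sum_congr rfl fun u _ => by ring
  · exact (hm s).trans (hF s hs)

variable [MeasurableSpace S] [MeasurableSingletonClass S]

theorem marginalSupport_subset_safeRecurrentSet {f : S × U → ℝ} (hf : f ∈ feasibleSet Q F)
    (G : Policy S U) : marginalSupport f ⊆ safeRecurrentSet Q F (policyOf f hf.1 G) := by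
  intro s hs
  have hst := marginal_eq_sum_closedLoop hf G
  rw [mem_safeRecurrentSet_iff]
  refine ⟨avoid_singleton_self_eq_zero (closedLoop_nonneg Q _) (sum_closedLoop Q _) hst hs.ne',
    avoid_eq_one_of_closed (sum_closedLoop Q _) (A := marginalSupport f) ?_ ?_ hs⟩
  · exact fun x hx z hz =>
      stationary_pos (closedLoop_nonneg Q _) (marginal_nonneg hf.1) hst hx hz
  · exact Set.disjoint_left.2 fun x hx hxF => hx.ne' (hf.2.2 x hxF)

/-- A safe recurrent state is charged by a stationary distribution that does not charge `F`. -/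
theorem exists_stationary_of_mem_safeRecurrentSet {K : Policy S U} {s : S}
    (hs : s ∈ safeRecurrentSet Q F K) :
    ∃ π ∈ stdSimplex ℝ S, (∀ z, π z = ∑ x, closedLoop Q K z x * π x) ∧ (∀ x ∈ F, π x = 0) ∧
      0 < π s := by
  rw [mem_safeRecurrentSet_iff] at hs
  obtain ⟨hrec, hsafe⟩ := hs
  have hp := closedLoop_nonneg Q K
  have hp1 := sum_closedLoop Q K
  -- Take the states that surely reach `s` and surely avoid `F`. As `avoid` ignores time `0`, this
  -- set may itself meet `F`; hence the separate claim that successors lie outside `F`.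
  have hC : ∀ x ∈ {x | avoid (closedLoop Q K) {s} x = 0 ∧ avoid (closedLoop Q K) F x = 1},
      ∀ z, closedLoop Q K z x ≠ 0 →
        z ∈ {x | avoid (closedLoop Q K) {s} x = 0 ∧ avoid (closedLoop Q K) F x = 1} ∧ z ∉ F := by
    rintro x ⟨h0, h1⟩ z hz
    have hz0 := indicator_avoid_eq_zero hp hp1 h0 hz
    have hz1 := indicator_avoid_eq_one hp hp1 h1 hz
    have hzF : z ∉ F := fun hzF => by simp [hzF] at hz1
    refine ⟨⟨?_, by simpa [hzF] using hz1⟩, hzF⟩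
    by_cases hzs : z = s
    · rw [hzs, hrec]
    · simpa [hzs] using hz0
  obtain ⟨π, hπ, hst, hsupp⟩ := exists_stationary_of_closed hp hp1
    (C := {x | avoid (closedLoop Q K) {s} x = 0 ∧ avoid (closedLoop Q K) F x = 1}) ⟨s, hrec, hsafe⟩
    fun x hx z hz => (hC x hx z hz).1
  have hmem : ∀ x, π x ≠ 0 → avoid (closedLoop Q K) {s} x = 0 ∧ avoid (closedLoop Q K) F x = 1 :=
    fun x hx => by_contra fun h => hx (hsupp x h)
  refine ⟨π, hπ, hst, fun z hz => ?_, ?_⟩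
  -- Mass at `z ∈ F` could only flow in from the closed set, which never steps into `F`.
  · rw [hst z]
    refine sum_eq_zero fun x _ => mul_eq_zero.2 (or_iff_not_imp_right.2 fun hx => ?_)
    exact by_contra fun h => (hC x (hmem x hx) z h).2 hz
  · by_contra hπs
    obtain ⟨x, -, hx⟩ : ∃ x ∈ univ, π x ≠ 0 :=
      exists_ne_zero_of_sum_ne_zero (by rw [hπ.2]; exact one_ne_zero)
    -- If `π s = 0`, the support of `π` is closed and misses `s`, yet its states surely reach `s`.
    have h1 : avoid (closedLoop Q K) {s} x = 1 :=
      avoid_eq_one_of_closed hp1 (A := {x | 0 < π x})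
        (fun y hy z hz => stationary_pos hp hπ.1 hst hy hz)
        (Set.disjoint_singleton_right.2 hπs) (lt_of_le_of_ne (hπ.1 x) hx.symm)
    exact zero_ne_one ((hmem x hx).1.symm.trans h1)

theorem maxSafeRecurrentSet_subset_marginalSupport {f : S × U → ℝ} (hf : IsOptimal Q F f) :
    maxSafeRecurrentSet Q F ⊆ marginalSupport f := by
  refine Set.iUnion_subset fun K s hs => ?_
  obtain ⟨π, hπ, hst, hF, hπs⟩ := exists_stationary_of_mem_safeRecurrentSet hs
  obtain ⟨u, -, hu⟩ : ∃ u ∈ univ, K u s ≠ 0 :=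
    exists_ne_zero_of_sum_ne_zero (by rw [K.sum_prob]; exact one_ne_zero)
  have hpos := hf.pos_of_pos (mem_feasibleSet_of_stationary K hπ hst hF) (i := (s, u))
    (mul_pos hπs (lt_of_le_of_ne (K.prob_nonneg u s) hu.symm))
  exact sum_pos' (fun v _ => hf.1.1.1 (s, v)) ⟨u, mem_univ u, hpos⟩

end Policies

end Surveillance

theorem proposition1 {S U : Type*} [Fintype S] [Fintype U]
    [MeasurableSpace S] [MeasurableSingletonClass S]
    (Q : Surveillance.Dynamics S U) (F : Set S)
    (hfeas : (Surveillance.feasibleSet Q F).Nonempty) :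
    (∃! f : S × U → ℝ, Surveillance.IsOptimal Q F f) ∧
    ∀ (f : S × U → ℝ) (hf : Surveillance.IsOptimal Q F f),
      Surveillance.maxSafeRecurrentSet Q F = Surveillance.marginalSupport f ∧
      ∀ G : Surveillance.Policy S U,
        Surveillance.safeRecurrentSet Q F (Surveillance.policyOf f hf.1.1 G) =
          Surveillance.maxSafeRecurrentSet Q F := by
  refine ⟨Surveillance.existsUnique_isOptimal Q F hfeas, fun f hf => ?_⟩
  have hsub := Surveillance.maxSafeRecurrentSet_subset_marginalSupport hf
  have hle : ∀ K, Surveillance.safeRecurrentSet Q F K ⊆ Surveillance.maxSafeRecurrentSet Q F :=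
    fun K => Set.subset_iUnion (Surveillance.safeRecurrentSet Q F) K
  have hsup := Surveillance.marginalSupport_subset_safeRecurrentSet hf.1
  have ⟨G₀⟩ := Surveillance.nonempty_policy hf.1.1
  exact ⟨hsub.antisymm ((hsup G₀).trans (hle _)),
    fun G => (hle _).antisymm (hsub.trans (hsup G))⟩
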